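/- Write $\mathbb T=\mathbb R/2\pi\mathbb Z$, identified with $[-\pi,\pi)$ and equipped with Lebesgue measure $dt$ (total mass $2\pi$). For $t\in\mathbb T$, $t\neq\pm\pi/2$, and $(m,n)\in\mathbb Z^2$ let \[ e_t(m,n)=e^{itm}\Big(\frac{1+ie^{it}}{i+e^{it}}\Big)^n . \] Fix $0<\alpha<\pi/2$ and let $D_\alpha=\{t:|t|\le\alpha\}\cup\{t:\pi-\alpha\le|t|\le\pi\}\subseteq\mathbb T$. Let $PW_\alpha$ be the set of all functions $F:\mathbb Z^2\to\mathbb C$ such that (a) $F$ is discrete entire, i.e. $F(m+1,n+1)-F(m,n)=-i\big(F(m,n+1)-F(m+1,n)\big)$ for all $(m,n)\in\mathbb Z^2$; (b) there is $c>0$ with $|F(m,n)|\le c\,|e_{-\alpha}(0,1)|^{|n|}$ for all $(m,n)\in\mathbb Z^2$; (c) $\sum_{m\in\mathbb Z}|F(m,0)|^2<\infty$; and put $\|F\|_{PW_\alpha}=\big(\sum_{m\in\mathbb Z}|F(m,0)|^2\big)^{1/2}$. Theorem. Let $F\in PW_\alpha$. Then there exists $f\in L^2(\mathbb T)$ with $\operatorname{supp}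 f\subseteq D_\alpha$ such that, for all $(m,n)\in\mathbb Z^2$, the integral below converges absolutely and \[ F(m,n)=\frac1{2\pi}\int_{\mathbb T}f(t)\,e_t(m,n)\,dt , \qquad (1) \] and moreover \[ \|F\|_{PW_\alpha}=(2\pi)^{-1/2}\|f\|_{L^2(\mathbb T)} . \qquad (2) \] Conversely, let $f\in L^2(\mathbb T)$ with $\operatorname{supp} f\subseteq D_\alpha$. Then the integrals in (1) converge absolutely for all $(m,n)\in\mathbb Z^2$, the function $F$ defined by (1) belongs to $PW_\alpha$, and (2) holds. Here $\operatorname{supp} f$ is the complement of the largest open subset of $\mathbb T$ on which $f=0$ almost everywhere. -/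

import Mathlib

open MeasureTheory

noncomputable section

namespace DiscretePaleyWiener

/-- The one-dimensional torus `ℝ / 2πℤ`.  Its `volume` is Lebesgue measure `dt`, of total
mass `2π`. -/
abbrev Torus : Type := AddCircle (2 * Real.pi)

instance fact_two_pi_pos : Fact (0 < 2 * Real.pi) := ⟨Real.two_pi_pos⟩

/-- A function on the square lattice is discrete entire if
`F(m+1,n+1) - F(m,n) = -i (F(m,n+1) - F(m+1,n))` at every lattice point. -/
def IsDiscreteEntire (F : ℤ × ℤ → ℂ) : Prop :=
  ∀ m n : ℤ, F (m + 1, n + 1) - F (m, n) = -Complex.I * (F (m, n + 1) - F (m + 1, n))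

/-- The discrete exponential `e_t(m,n) = e^{itm} ((1 + i e^{it}) / (i + e^{it}))^n`.  Only its
values at `t ≠ ±π/2` are meaningful.  Here `AddCircle.toCircle t` is `e^{it}`, see
`discreteExp_coe`. -/
def discreteExp (t : Torus) (p : ℤ × ℤ) : ℂ :=
  (AddCircle.toCircle t : ℂ) ^ p.1 *
    ((1 + Complex.I * (AddCircle.toCircle t : ℂ)) /
      (Complex.I + (AddCircle.toCircle t : ℂ))) ^ p.2

theorem toCircle_coe (x : ℝ) :
    (AddCircle.toCircle (x : Torus) : ℂ) = Complex.exp (Complex.I * x) := by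
  rw [AddCircle.toCircle_apply_mk, Circle.coe_exp,
    div_self (ne_of_gt Real.two_pi_pos), one_mul, mul_comm]

theorem discreteExp_coe (x : ℝ) (m n : ℤ) :
    discreteExp (x : Torus) (m, n) =
      Complex.exp (Complex.I * x * m) *
        ((1 + Complex.I * Complex.exp (Complex.I * x)) /
          (Complex.I + Complex.exp (Complex.I * x))) ^ n := by
  rw [discreteExp, toCircle_coe, ← Complex.exp_int_mul, mul_comm (m : ℂ)]

/-- The set `D_α = {|t| ≤ α} ∪ {π - α ≤ |t| ≤ π}`, as a subset of the torus. -/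
def spectralSet (α : ℝ) : Set Torus :=
  (fun x : ℝ => (x : Torus)) ''
    ({x : ℝ | |x| ≤ α} ∪ {x : ℝ | Real.pi - α ≤ |x| ∧ |x| ≤ Real.pi})

/-- The support of an almost-everywhere class of functions on the torus: the complement of
the union of all open sets on which the function vanishes almost everywhere. -/
def essSupport (f : Torus → ℂ) : Set Torus :=
  {t | ∀ U : Set Torus, IsOpen U → t ∈ U → ¬ ∀ᵐ s ∂(volume.restrict U), f s = 0}

/-- The Paley--Wiener space `PW_α`. -/
def paleyWiener (α : ℝ) : Set (ℤ × ℤ → ℂ) :=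
  {F | IsDiscreteEntire F ∧
    (∃ c : ℝ, 0 < c ∧ ∀ m n : ℤ,
      ‖F (m, n)‖ ≤ c * ‖discreteExp ((-α : ℝ) : Torus) (0, 1)‖ ^ n.natAbs) ∧
    Summable fun m : ℤ => ‖F (m, 0)‖ ^ 2}

/-- The norm of `PW_α`: the `ℓ²` norm of the row `n = 0`. -/
def pwNorm (F : ℤ × ℤ → ℂ) : ℝ :=
  Real.sqrt (∑' m : ℤ, ‖F (m, 0)‖ ^ 2)

/-- The function `(m,n) ↦ (1/2π) ∫_𝕋 f(t) e_t(m,n) dt`. -/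
def synthesis (f : Torus → ℂ) (p : ℤ × ℤ) : ℂ :=
  (1 / (2 * (Real.pi : ℂ))) * ∫ t : Torus, f t * discreteExp t p

end DiscretePaleyWiener

end

noncomputable section

namespace DiscretePaleyWiener

open Filter Topology
open scoped ContDiff

/-! On the row `n = 0` formula (1) is a Fourier series, so Riesz–Fischer produces `f` and Parseval
gives (2). Two points remain: `f` must vanish off `D_α`, and the row `n = 0` must determine `F`.

Vanishing. Let `g` be a test function on an arc `(-π+β, -β)` with `α < β`, and let `c_n(m)` be the
Fourier integrals of `g(t) e_t(0,1)^{-n}`. The reciprocal `cos t / (1 - sin t)` is smooth on this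
arc, even across the pole `t = -π/2` of `e_t(0,1)`, where it is taken to be 0. Summation by parts
and the discrete entire equation show that `∑ F(m,n) (c_n(m) + i c_n(m-1))` does not depend on `n`
(`tsum_pairing_eq`, `powCoeff_succ`). Repeated integration by parts bounds `c_n(m)` by a summable
function of `m` times `(n+1)² ρ^n`, with `ρ = |e_{-β}(0,1)|⁻¹`, while `F(m,n)` grows at most like
`M^n`, with `M = |e_{-α}(0,1)|`. Since `Mρ < 1`, the sum tends to 0, hence is 0 at `n = 0`. By
Parseval, `(1 + i e^{it}) f` is orthogonal to every `g`, so `f = 0` on the lower arc. The symmetry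
`(m,n) ↦ (-m,-n)` handles the upper arc.

Uniqueness. If a row vanishes, the next is a multiple of `(-i)^m`; this makes the row after it grow
linearly unless the multiple is 0 (`row_succ_eq_zero`).

The converse is integration of the exponentials, which satisfy the growth bound uniformly on `D_α`.
-/

/-! ### The discrete exponential in real form and its size -/

/-- The real function `cos x / (1 + sin x)`, which is the value `e_x(0,1)`. -/
def ratio (x : ℝ) : ℝ := Real.cos x / (1 + Real.sin x)

theorem discreteExp_ratio (x : ℝ) (m n : ℤ) :
    discreteExp (x : Torus) (m, n) = Complex.exp (Complex.I * x * m) * (ratio x : ℂ) ^ n := by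
  rw [discreteExp_coe]
  congr 2
  have hz : Complex.exp (Complex.I * x) = Real.cos x + Real.sin x * Complex.I := by
    rw [mul_comm, Complex.exp_mul_I]; push_cast; rfl
  have hsc : (Real.cos x : ℂ) ^ 2 = 1 - (Real.sin x : ℂ) ^ 2 := by
    rw [eq_sub_iff_add_eq]; exact_mod_cast Real.cos_sq_add_sin_sq x
  rw [hz, ratio]
  generalize Real.cos x = c at *
  generalize Real.sin x = s at *
  -- At the pole both quotients have denominator 0, and division by zero makes both equal to 0.
  by_cases h : 1 + s = 0
  · have hs : s = -1 := by linarith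
    have hc : c = 0 := by
      have : (c : ℂ) ^ 2 = 0 := by rw [hsc, hs]; push_cast; ring
      exact_mod_cast pow_eq_zero_iff (two_ne_zero) |>.1 this
    subst hs; subst hc; simp
  · have h1 : (1 + s : ℂ) ≠ 0 := by exact_mod_cast h
    have h2 : Complex.I + (c + s * Complex.I) ≠ 0 := by
      intro h0
      have := congrArg Complex.im h0
      simp at this
      exact h this
    push_cast
    rw [div_eq_div_iff h2 h1]
    linear_combination (s + 1) * s * Complex.I_sq - hsc

theorem ratio_sq {x : ℝ} (h : 1 + Real.sin x ≠ 0) :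
    ratio x ^ 2 = (1 - Real.sin x) / (1 + Real.sin x) := by
  rw [ratio, div_pow, div_eq_div_iff (pow_ne_zero _ h) h, Real.cos_sq']
  ring

theorem ratio_neg (x : ℝ) (h : Real.cos x ≠ 0) : ratio (-x) = (ratio x)⁻¹ := by
  have hp : (1 + Real.sin x) * (1 - Real.sin x) = Real.cos x ^ 2 := by rw [Real.cos_sq']; ring
  have hne : (1 + Real.sin x) * (1 - Real.sin x) ≠ 0 := by rw [hp]; exact pow_ne_zero _ h
  have h1 := left_ne_zero_of_mul hne
  have h2 := right_ne_zero_of_mul hne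
  rw [ratio, ratio, Real.cos_neg, Real.sin_neg, inv_div, ← sub_eq_add_neg,
    div_eq_div_iff h2 h]
  linarith

theorem norm_discreteExp_zero_one (x : ℝ) :
    ‖discreteExp (x : Torus) (0, 1)‖ = |ratio x| := by
  rw [discreteExp_ratio]; simp

theorem norm_discreteExp (x : ℝ) (m n : ℤ) :
    ‖discreteExp (x : Torus) (m, n)‖ = |ratio x| ^ n := by
  rw [discreteExp_ratio, norm_mul, norm_zpow]
  have : Complex.exp (Complex.I * x * m) = Complex.exp (((x * m : ℝ) : ℂ) * Complex.I) := by
    congr 1; push_cast; ring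
  rw [this, Complex.norm_exp_ofReal_mul_I]; simp

/-- If `|sin x| ≤ sin α` then both `|e_x(0,1)|` and its inverse are at most `|e_{-α}(0,1)|`. -/
theorem abs_ratio_zpow_le {α x : ℝ} (hα : Real.sin α < 1) (hx : |Real.sin x| ≤ Real.sin α)
    (n : ℤ) : |ratio x| ^ n ≤ |ratio (-α)| ^ n.natAbs := by
  obtain ⟨hx1, hx2⟩ := abs_le.1 hx
  have key : ∀ y : ℝ, |Real.sin y| ≤ Real.sin α → |ratio y| ≤ |ratio (-α)| := by
    intro y hy
    obtain ⟨h1, h2⟩ := abs_le.1 hy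
    apply sq_le_sq.1
    rw [ratio_sq (by linarith), ratio_sq (by rw [Real.sin_neg]; linarith), Real.sin_neg,
      div_le_div_iff₀ (by linarith) (by linarith)]
    nlinarith
  obtain ⟨k, rfl | rfl⟩ := n.eq_nat_or_neg
  · simpa using pow_le_pow_left₀ (abs_nonneg _) (key x hx) k
  · have hc : Real.cos x ≠ 0 := by
      intro h0
      have := Real.sin_sq_add_cos_sq x
      rw [h0] at this
      nlinarith
    have h2 := key (-x) (by rwa [Real.sin_neg, abs_neg])
    rw [ratio_neg x hc, abs_inv] at h2
    simpa using pow_le_pow_left₀ (by positivity) h2 k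

/-! ### The set `D_α` and the exponentials on it -/

theorem isClosed_spectralSet (α : ℝ) : IsClosed (spectralSet α) := by
  apply IsCompact.isClosed
  apply IsCompact.image _ (AddCircle.continuous_mk' _)
  apply Metric.isCompact_of_isClosed_isBounded
  · exact (isClosed_le continuous_abs continuous_const).union
      ((isClosed_le continuous_const continuous_abs).inter
        (isClosed_le continuous_abs continuous_const))
  · apply (Metric.isBounded_closedBall (x := (0 : ℝ)) (r := max |α| Real.pi)).subset
    intro x hx
    simp only [Metric.mem_closedBall, dist_zero_right, Real.norm_eq_abs]
    rcases hx with hx | hx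
    · exact le_trans hx ((le_abs_self α).trans (le_max_left _ _))
    · exact hx.2.trans (le_max_right _ _)

theorem abs_sin_le_of_mem_spectralSet {α : ℝ} (hα : 0 < α) (hα' : α < Real.pi / 2) {t : Torus}
    (ht : t ∈ spectralSet α) : ∃ x : ℝ, (x : Torus) = t ∧ |Real.sin x| ≤ Real.sin α := by
  obtain ⟨x, hx, rfl⟩ := ht
  refine ⟨x, rfl, ?_⟩
  have key : ∀ y : ℝ, |y| ≤ α → |Real.sin y| ≤ Real.sin α := by
    intro y hy
    obtain ⟨h1, h2⟩ := abs_le.1 hy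
    rw [abs_le, ← Real.sin_neg]
    exact ⟨Real.sin_le_sin_of_le_of_le_pi_div_two (by linarith) (by linarith) h1,
      Real.sin_le_sin_of_le_of_le_pi_div_two (by linarith) (by linarith) h2⟩
  rcases hx with hx | ⟨h1, h2⟩
  · exact key x hx
  · rcases abs_cases x with ⟨h, _⟩ | ⟨h, _⟩
    · rw [← Real.sin_pi_sub]
      exact key _ (by rw [abs_le]; constructor <;> linarith)
    · rw [← abs_neg, ← Real.sin_add_pi]
      exact key _ (by rw [abs_le]; constructor <;> linarith)

theorem norm_discreteExp_le_of_mem_spectralSet {α : ℝ} (hα : 0 < α) (hα' : α < Real.pi / 2)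
    {t : Torus} (ht : t ∈ spectralSet α) (m n : ℤ) :
    ‖discreteExp t (m, n)‖ ≤ ‖discreteExp ((-α : ℝ) : Torus) (0, 1)‖ ^ n.natAbs := by
  obtain ⟨x, rfl, hx⟩ := abs_sin_le_of_mem_spectralSet hα hα' ht
  rw [norm_discreteExp, norm_discreteExp_zero_one]
  refine abs_ratio_zpow_le ?_ hx n
  rw [← Real.sin_pi_div_two]
  exact Real.sin_lt_sin_of_lt_of_le_pi_div_two (by linarith) le_rfl hα'

theorem measurable_discreteExp (p : ℤ × ℤ) : Measurable fun t : Torus => discreteExp t p := by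
  have hc : Measurable fun t : Torus => (AddCircle.toCircle t : ℂ) :=
    (continuous_subtype_val.comp AddCircle.continuous_toCircle).measurable
  have hz : ∀ (k : ℤ) (g : Torus → ℂ), Measurable g → Measurable fun t => g t ^ k := by
    intro k g hg
    obtain ⟨j, rfl | rfl⟩ := k.eq_nat_or_neg
    · simpa using hg.pow_const j
    · simp only [zpow_neg, zpow_natCast]
      exact (hg.pow_const j).inv
  unfold discreteExp
  exact (hz _ _ hc).mul (hz _ _ (((hc.const_mul _).const_add _).div (hc.const_add _)))

/-! ### Essential support and vanishing almost everywhere -/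

/-- The union of null open sets may be uncountable; second countability makes a locally null set
null. -/
theorem ae_eq_zero_of_essSupport_subset {f : Torus → ℂ} {D : Set Torus}
    (h : essSupport f ⊆ D) : ∀ᵐ t : Torus, t ∉ D → f t = 0 := by
  rw [ae_iff]
  apply measure_null_of_locally_null
  intro t ht
  simp only [Classical.not_imp, Set.mem_ofPred_eq] at ht
  have h1 : t ∉ essSupport f := fun h' => ht.1 (h h')
  simp only [essSupport, Set.mem_ofPred_eq, not_forall, not_not] at h1
  obtain ⟨U, hU, htU, hf⟩ := h1
  refine ⟨U ∩ {s | ¬ (s ∉ D → f s = 0)}, ?_, ?_⟩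
  · exact Filter.inter_mem (mem_nhdsWithin_of_mem_nhds (hU.mem_nhds htU)) self_mem_nhdsWithin
  · rw [ae_restrict_iff' hU.measurableSet, ae_iff] at hf
    refine measure_mono_null ?_ hf
    rintro s ⟨hs, hs'⟩
    simp only [Classical.not_imp, Set.mem_ofPred_eq] at hs' ⊢
    exact ⟨hs, hs'.2⟩

theorem essSupport_subset_of_ae {f : Torus → ℂ} {D : Set Torus} (hD : IsClosed D)
    (h : ∀ᵐ t : Torus, t ∉ D → f t = 0) : essSupport f ⊆ D := by
  intro t ht
  by_contra htD
  exact ht Dᶜ hD.isOpen_compl htD ((ae_restrict_iff' hD.isOpen_compl.measurableSet).2 h)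

/-! ### Uniqueness from the row `n = 0` -/

theorem IsDiscreteEntire.reflect {F : ℤ × ℤ → ℂ} (hF : IsDiscreteEntire F) :
    IsDiscreteEntire fun p => F (-p.1, -p.2) := by
  intro m n
  have h := hF (-m - 1) (-n - 1)
  simp only [sub_add_cancel] at h
  simp only [neg_add, ← sub_eq_add_neg]
  linear_combination -h

/-- A bounded sequence with constant increments is constant. -/
theorem eq_zero_of_bounded_of_increment {a : ℤ → ℂ} {d : ℂ} {B : ℝ} (hB : ∀ m, ‖a m‖ ≤ B)
    (h : ∀ m, a (m + 1) = a m + d) : d = 0 := by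
  have h1 : ∀ k : ℕ, a k = a 0 + k * d := by
    intro k
    induction k with
    | zero => simp
    | succ k ih => push_cast; rw [h, ih]; ring
  by_contra hd
  obtain ⟨k, hk⟩ := exists_nat_gt (2 * B / ‖d‖)
  rw [div_lt_iff₀ (norm_pos_iff.2 hd)] at hk
  have h2 : (k : ℂ) * d = a k - a 0 := by rw [h1 k]; ring
  have h3 : (k : ℝ) * ‖d‖ = ‖a k - a 0‖ := by rw [← h2, norm_mul, Complex.norm_natCast]
  have h4 := norm_sub_le (a k) (a 0)
  linarith [hB k, hB 0]

theorem row_succ_eq_zero {H : ℤ × ℤ → ℂ} (hH : IsDiscreteEntire H) {n : ℤ} {B : ℝ}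
    (hB : ∀ m, ‖H (m, n + 1 + 1)‖ ≤ B) (h0 : ∀ m, H (m, n) = 0) (m : ℤ) :
    H (m, n + 1) = 0 := by
  have e1 : ∀ m, H (m + 1, n + 1) = -Complex.I * H (m, n + 1) := by
    intro m
    have := hH m n
    rw [h0, h0] at this
    linear_combination this
  have hI : ∀ k : ℤ, Complex.I ^ (k + 1) = Complex.I ^ k * Complex.I :=
    fun k => zpow_add_one₀ Complex.I_ne_zero k
  have e2 : ∀ m, Complex.I ^ m * H (m, n + 1) = H (0, n + 1) := by
    have hs : ∀ m, Complex.I ^ (m + 1) * H (m + 1, n + 1) = Complex.I ^ m * H (m, n + 1) := by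
      intro m
      rw [e1, hI]
      linear_combination (-Complex.I ^ m * H (m, n + 1)) * Complex.I_sq
    intro m
    induction m using Int.induction_on with
    | zero => simp
    | succ i ih => rw [hs, ih]
    | pred i ih => rw [← ih, ← hs]; simp
  -- The factor `i^m` cancels the homogeneous solution `(-i)^m`, so the recurrence for the row `n +
  -- 2` becomes one with constant increment.
  have e3 := eq_zero_of_bounded_of_increment (a := fun m => Complex.I ^ m * H (m, n + 1 + 1))
    (d := 2 * Complex.I * H (0, n + 1)) (B := B) (by intro m; simpa using hB m) (by
      intro m
      have h1 := hH m (n + 1)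
      rw [e1] at h1
      rw [← e2 m]
      simp only [hI]
      linear_combination (Complex.I ^ m * Complex.I) * h1 -
        Complex.I ^ m * H (m, n + 1 + 1) * Complex.I_sq -
        Complex.I ^ m * Complex.I * H (m, n + 1) * Complex.I_sq)
  have e4 : H (0, n + 1) = 0 := by simpa using e3
  have := e2 m
  rw [e4] at this
  exact (mul_eq_zero.1 this).resolve_left (zpow_ne_zero _ Complex.I_ne_zero)

/-- A discrete entire function with bounded rows is determined by its row `n = 0`. -/
theorem IsDiscreteEntire.eq_zero {H : ℤ × ℤ → ℂ} (hH : IsDiscreteEntire H)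
    (hB : ∀ n, ∃ B : ℝ, ∀ m, ‖H (m, n)‖ ≤ B) (h0 : ∀ m, H (m, 0) = 0) (m n : ℤ) :
    H (m, n) = 0 := by
  have key : ∀ G : ℤ × ℤ → ℂ, IsDiscreteEntire G → (∀ n, ∃ B : ℝ, ∀ m, ‖G (m, n)‖ ≤ B) →
      (∀ m, G (m, 0) = 0) → ∀ (k : ℕ) (m : ℤ), G (m, k) = 0 := by
    intro G hG hB h0 k
    induction k with
    | zero => simpa using h0
    | succ k ih =>
      obtain ⟨B, hB⟩ := hB (k + 1 + 1)
      push_cast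
      exact row_succ_eq_zero hG hB ih
  obtain ⟨k, rfl | rfl⟩ := n.eq_nat_or_neg
  · exact key H hH hB h0 k m
  · have := key _ hH.reflect (fun n => (hB (-n)).imp fun B hB m => hB (-m))
      (fun m => by simpa using h0 (-m)) k (-m)
    simpa using this

/-! ### Fourier series of the row `n = 0` -/

theorem discreteExp_row_zero (t : Torus) (m : ℤ) : discreteExp t (m, 0) = fourier m t := by
  rw [fourier_apply, AddCircle.toCircle_zsmul]
  simp [discreteExp]

theorem synthesis_row_zero (f : Torus → ℂ) (m : ℤ) :
    synthesis f (m, 0) = fourierCoeff f (-m) := by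
  rw [synthesis, fourierCoeff, AddCircle.integral_haarAddCircle, Complex.real_smul]
  push_cast
  rw [one_div]
  congr 1
  refine integral_congr_ae (ae_of_all _ fun t => ?_)
  simp only [discreteExp_row_zero, neg_neg, smul_eq_mul, mul_comm]

theorem fourierCoeff_toLp_eq {f : Torus → ℂ} (hf : MemLp f 2 AddCircle.haarAddCircle) (m : ℤ) :
    fourierCoeff (hf.toLp f) m = fourierCoeff f m :=
  congrFun (fourierCoeff_congr_ae hf.coeFn_toLp) m

theorem hasSum_sq_synthesis_row_zero {f : Torus → ℂ} (hf : MemLp f 2) :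
    HasSum (fun m : ℤ => ‖synthesis f (m, 0)‖ ^ 2)
      ((2 * Real.pi)⁻¹ * ∫ t : Torus, ‖f t‖ ^ 2) := by
  have hf' := hf.haarAddCircle
  have h := hasSum_sq_fourierCoeff (hf'.toLp f)
  have h2 : ∫ t : Torus, ‖hf'.toLp f t‖ ^ 2 ∂AddCircle.haarAddCircle =
      (2 * Real.pi)⁻¹ * ∫ t : Torus, ‖f t‖ ^ 2 := by
    refine Eq.trans ?_ (AddCircle.integral_haarAddCircle (T := 2 * Real.pi))
    refine integral_congr_ae ?_
    filter_upwards [hf'.coeFn_toLp] with t ht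
    rw [ht]
  rw [h2] at h
  refine ((Equiv.neg ℤ).hasSum_iff.2 h).congr_fun ?_
  intro m
  simp [synthesis_row_zero, fourierCoeff_toLp_eq hf']

theorem pwNorm_synthesis (f : Lp ℂ 2 (volume : Measure Torus)) :
    pwNorm (synthesis f) = (2 * Real.pi) ^ (-(1 / 2) : ℝ) * ‖f‖ := by
  have hn : ∫ t : Torus, ‖f t‖ ^ 2 = ‖f‖ ^ 2 := by
    have h := congr_arg RCLike.re (@L2.inner_def Torus ℂ ℂ _ _ _ _ _ f f)
    rw [← integral_re (L2.integrable_inner f f)] at h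
    simp only [← norm_sq_eq_re_inner] at h
    exact h.symm
  rw [pwNorm, (hasSum_sq_synthesis_row_zero (Lp.memLp f)).tsum_eq, hn,
    Real.sqrt_mul (by positivity), Real.sqrt_sq (norm_nonneg _), Real.sqrt_inv,
    Real.rpow_neg (by positivity), Real.sqrt_eq_rpow]

/-- Riesz–Fischer; the index is negated because `fourierCoeff` integrates against `e^{-imt}`. -/
theorem exists_synthesis_row_zero {a : ℤ → ℂ} (ha : Summable fun m => ‖a m‖ ^ 2) :
    ∃ f : Lp ℂ 2 (volume : Measure Torus), ∀ m : ℤ, synthesis f (m, 0) = a m := by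
  have hl : Memℓp (fun m => a (-m)) 2 := by
    apply memℓp_gen
    simpa [Function.comp_def] using (Equiv.neg ℤ).summable_iff.2 ha
  obtain ⟨g, hg⟩ := (fourierBasis (T := 2 * Real.pi)).repr.surjective ⟨_, hl⟩
  have hg2 : MemLp g 2 (volume : Measure Torus) := (Lp.memLp g).of_haarAddCircle
  refine ⟨hg2.toLp g, fun m => ?_⟩
  -- Fourier coefficients use normalized Haar measure, which has the same null sets as `volume`.
  have hae : (hg2.toLp g : Torus → ℂ) =ᵐ[AddCircle.haarAddCircle] g := by
    refine Measure.AbsolutelyContinuous.ae_eq ?_ hg2.coeFn_toLp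
    rw [AddCircle.volume_eq_smul_haarAddCircle]
    exact Measure.absolutelyContinuous_smul (by simp [Real.pi_pos])
  rw [synthesis_row_zero, congrFun (fourierCoeff_congr_ae hae), ← fourierBasis_repr, hg]
  simp

/-- Parseval in bilinear form: applying it to `star G` undoes the conjugation in the inner product.
-/
theorem hasSum_fourierCoeff_mul_synthesis {f G : Torus → ℂ} (hf : MemLp f 2) (hG : MemLp G 2) :
    HasSum (fun m : ℤ => synthesis f (m, 0) * fourierCoeff G m)
      ((2 * Real.pi : ℂ)⁻¹ * ∫ t : Torus, G t * f t) := by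
  have hf' := hf.haarAddCircle
  have hG' : MemLp (star G) 2 (AddCircle.haarAddCircle (T := 2 * Real.pi)) :=
    hG.haarAddCircle.star
  have h := (fourierBasis (T := 2 * Real.pi)).hasSum_inner_mul_inner (hG'.toLp _) (hf'.toLp f)
  have h2 : inner ℂ (hG'.toLp _) (hf'.toLp f) =
      (2 * Real.pi : ℂ)⁻¹ * ∫ t : Torus, G t * f t := by
    rw [L2.inner_def]
    have := AddCircle.integral_haarAddCircle (T := 2 * Real.pi) (f := fun t => G t * f t)
    rw [Complex.real_smul] at this
    push_cast at this
    rw [← this]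
    refine integral_congr_ae ?_
    filter_upwards [hf'.coeFn_toLp, hG'.coeFn_toLp] with t ht ht'
    rw [ht, ht', RCLike.inner_apply]
    simp [mul_comm]
  rw [h2] at h
  refine ((Equiv.neg ℤ).hasSum_iff.2 h).congr_fun ?_
  intro m
  simp only [Function.comp_apply, Equiv.neg_apply]
  rw [← inner_conj_symm, ← HilbertBasis.repr_apply_apply, ← HilbertBasis.repr_apply_apply,
    fourierBasis_repr, fourierBasis_repr, fourierCoeff_toLp_eq hf', fourierCoeff_toLp_eq hG',
    synthesis_row_zero, mul_comm]
  congr 1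
  rw [fourierCoeff, fourierCoeff, ← integral_conj]
  refine integral_congr_ae (ae_of_all _ fun t => ?_)
  simp

/-! ### Decay of the Fourier integrals of `G u ^ n` -/

/-- The Fourier integral of `G u ^ n` over `[a, b]`. -/
def powCoeff (a b : ℝ) (u G : ℝ → ℝ) (n : ℕ) (m : ℤ) : ℂ :=
  ∫ t in a..b, ((G t * u t ^ n : ℝ) : ℂ) * Complex.exp (-(Complex.I * m * t))

theorem continuousOn_powCoeff_integrand {s : Set ℝ} {u G : ℝ → ℝ} (hu : ContinuousOn u s)
    (hG : ContinuousOn G s) (n : ℕ) (m : ℤ) :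
    ContinuousOn
      (fun t : ℝ => ((G t * u t ^ n : ℝ) : ℂ) * Complex.exp (-(Complex.I * m * t))) s := by
  refine ContinuousOn.mul ?_ (Continuous.continuousOn (by fun_prop))
  exact Complex.continuous_ofReal.comp_continuousOn (hG.mul (hu.pow n))

theorem norm_exp_neg_I_mul (m : ℤ) (t : ℝ) : ‖Complex.exp (-(Complex.I * m * t))‖ = 1 := by
  have : -(Complex.I * m * t) = ((-(m * t) : ℝ) : ℂ) * Complex.I := by push_cast; ring
  rw [this, Complex.norm_exp_ofReal_mul_I]

/-- Integration by parts for a factor `u` satisfying `u' = (1 + u²) / 2`. -/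
theorem powCoeff_by_parts {a b : ℝ} (hab : a ≤ b) {u G : ℝ → ℝ}
    (hu : ∀ x ∈ Set.Icc a b, HasDerivAt u ((1 + u x ^ 2) / 2) x) (hG : ContDiff ℝ 1 G)
    (hGs : tsupport G ⊆ Set.Ioo a b) (n : ℕ) (m : ℤ) :
    Complex.I * m * powCoeff a b u G n m = powCoeff a b u (deriv G) n m +
      n / 2 * (powCoeff a b u G (n - 1) m + powCoeff a b u G (n + 1) m) := by
  have huc : ContinuousOn u (Set.uIcc a b) := by
    rw [Set.uIcc_of_le hab]
    exact fun x hx => (hu x hx).continuousAt.continuousWithinAt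
  have hi : ∀ (H : ℝ → ℝ) (_ : Continuous H) (k : ℕ), IntervalIntegrable
      (fun t : ℝ => ((H t * u t ^ k : ℝ) : ℂ) * Complex.exp (-(Complex.I * m * t))) volume a b :=
    fun H hH k => (continuousOn_powCoeff_integrand huc hH.continuousOn k m).intervalIntegrable
  have hG' : Continuous (deriv G) := hG.continuous_deriv le_rfl
  have i1 := hi _ hG' n
  have i2 := (hi _ hG.continuous (n - 1)).add (hi _ hG.continuous (n + 1))
  have i3 := hi _ hG.continuous n
  have hza : G a = 0 := image_eq_zero_of_notMem_tsupport fun h => lt_irrefl _ (hGs h).1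
  have hzb : G b = 0 := image_eq_zero_of_notMem_tsupport fun h => lt_irrefl _ (hGs h).2
  have key := intervalIntegral.integral_eq_sub_of_hasDerivAt (a := a) (b := b)
    (f := fun t : ℝ => ((G t * u t ^ n : ℝ) : ℂ) * Complex.exp (-(Complex.I * m * t)))
    (f' := fun t : ℝ => ((deriv G t * u t ^ n : ℝ) : ℂ) * Complex.exp (-(Complex.I * m * t)) +
      (n / 2 : ℂ) * (((G t * u t ^ (n - 1) : ℝ) : ℂ) * Complex.exp (-(Complex.I * m * t)) +
        ((G t * u t ^ (n + 1) : ℝ) : ℂ) * Complex.exp (-(Complex.I * m * t))) -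
      (Complex.I * m) * (((G t * u t ^ n : ℝ) : ℂ) * Complex.exp (-(Complex.I * m * t)))) ?_
      ((i1.add (i2.const_mul _)).sub (i3.const_mul _))
  · rw [intervalIntegral.integral_sub (i1.add (i2.const_mul _)) (i3.const_mul _),
      intervalIntegral.integral_add i1 (i2.const_mul _),
      intervalIntegral.integral_const_mul, intervalIntegral.integral_const_mul,
      intervalIntegral.integral_add (hi _ hG.continuous _) (hi _ hG.continuous _), hza, hzb] at key
    simp only [zero_mul, Complex.ofReal_zero, sub_zero] at key
    exact (sub_eq_zero.1 key).symm
  · intro x hx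
    rw [Set.uIcc_of_le hab] at hx
    have d1 : HasDerivAt G (deriv G x) x := (hG.differentiable one_ne_zero x).hasDerivAt
    have d2 := (d1.mul ((hu x hx).pow n)).ofReal_comp
    have d3 : HasDerivAt (fun t : ℝ => Complex.exp (-(Complex.I * m * t)))
        (Complex.exp (-(Complex.I * m * x)) * (-(Complex.I * m * 1))) x :=
      ((((hasDerivAt_id x).ofReal_comp).const_mul (Complex.I * m)).neg).cexp
    refine (d2.mul d3).congr_deriv ?_
    -- For `n = 0` the truncated exponent `n - 1` is harmless, since its term carries the factor `n
    -- / 2`.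
    cases n with
    | zero => simp; ring
    | succ k =>
      simp only [Nat.add_sub_cancel, Pi.mul_apply, Pi.pow_apply]
      push_cast
      ring

/-- Each integration by parts gains a factor `|m|` and costs one factor `n + 1`, without changing
the geometric rate. `G` is quantified inside the induction because the step also uses `deriv G`. -/
theorem norm_powCoeff_le {a b ρ : ℝ} (hab : a ≤ b) (hρ : 0 < ρ) {u : ℝ → ℝ}
    (hu : ∀ x ∈ Set.Icc a b, HasDerivAt u ((1 + u x ^ 2) / 2) x)
    (hur : ∀ x ∈ Set.Icc a b, |u x| ≤ ρ) (j : ℕ) :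
    ∀ G : ℝ → ℝ, ContDiff ℝ ∞ G → tsupport G ⊆ Set.Ioo a b →
      ∃ C : ℝ, 0 ≤ C ∧ ∀ (n : ℕ) (m : ℤ),
        |(m : ℝ)| ^ j * ‖powCoeff a b u G n m‖ ≤ C * (n + 1) ^ j * ρ ^ n := by
  induction j with
  | zero =>
    intro G hG hGs
    obtain ⟨C, hC⟩ := isCompact_Icc.exists_bound_of_continuousOn
      (hG.continuous.continuousOn (s := Set.Icc a b))
    have hC0 : 0 ≤ C := (norm_nonneg _).trans (hC a ⟨le_rfl, hab⟩)
    refine ⟨C * |b - a|, by positivity, fun n m => ?_⟩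
    have := intervalIntegral.norm_integral_le_of_norm_le_const (a := a) (b := b) (C := C * ρ ^ n)
      (f := fun t : ℝ => ((G t * u t ^ n : ℝ) : ℂ) * Complex.exp (-(Complex.I * m * t))) ?_
    · simp only [pow_zero, one_mul, mul_one]
      exact this.trans (le_of_eq (by ring))
    · intro x hx
      rw [Set.uIoc_of_le hab] at hx
      have hx' := Set.Ioc_subset_Icc_self hx
      rw [norm_mul, norm_exp_neg_I_mul, mul_one, Complex.norm_real, norm_mul, norm_pow]
      exact mul_le_mul (hC x hx') (pow_le_pow_left₀ (norm_nonneg _) (hur x hx') n)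
        (by positivity) hC0
  | succ j ih =>
    intro G hG hGs
    obtain ⟨C₁, hC₁, h₁⟩ := ih (deriv G) (hG.iterate_deriv 1)
      ((closure_mono support_deriv_subset).trans (by
        rw [closure_eq_iff_isClosed.2 (isClosed_tsupport G)]; exact hGs))
    obtain ⟨C₂, hC₂, h₂⟩ := ih G hG hGs
    -- The terms come from `G'`, from the exponent `n - 1`, and from the exponent `n + 1`, where `(n
    -- + 2)^j ≤ 2^j (n + 1)^j`.
    refine ⟨C₁ + C₂ * (ρ⁻¹ + 2 ^ j * ρ), by positivity, fun n m => ?_⟩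
    have hp := congrArg norm (powCoeff_by_parts hab hu (hG.of_le (mod_cast le_top)) hGs n m)
    rw [norm_mul, norm_mul, Complex.norm_I, one_mul, Complex.norm_intCast] at hp
    have e1 : (1 : ℝ) ≤ n + 1 := by linarith [n.cast_nonneg (α := ℝ)]
    have hb1 : (n : ℝ) * (|(m : ℝ)| ^ j * ‖powCoeff a b u G (n - 1) m‖) ≤
        (n + 1) * (C₂ * (n + 1) ^ j * ρ ^ n * ρ⁻¹) := by
      cases n with
      | zero => simp; positivity
      | succ k =>
        refine mul_le_mul (by simp) ((h₂ k m).trans ?_) (by positivity) (by positivity)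
        rw [pow_succ ρ, mul_assoc _ _ (ρ⁻¹), mul_assoc _ _ (ρ⁻¹), mul_inv_cancel₀ hρ.ne', mul_one]
        gcongr
        simp
    have hb2 : (n : ℝ) * (|(m : ℝ)| ^ j * ‖powCoeff a b u G (n + 1) m‖) ≤
        (n + 1) * (C₂ * (n + 1) ^ j * ρ ^ n * (2 ^ j * ρ)) := by
      refine mul_le_mul (by simp) ((h₂ (n + 1) m).trans ?_) (by positivity) (by positivity)
      have : ((n + 1 : ℕ) + 1 : ℝ) ^ j ≤ (n + 1) ^ j * 2 ^ j := by
        rw [← mul_pow]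
        refine pow_le_pow_left₀ (by positivity) ?_ j
        push_cast
        linarith
      calc _ ≤ C₂ * ((n + 1) ^ j * 2 ^ j) * ρ ^ (n + 1) := by gcongr
        _ = _ := by ring
    have hb0 := h₁ n m
    have hb0' : C₁ * (n + 1 : ℝ) ^ j * ρ ^ n ≤ C₁ * (n + 1 : ℝ) ^ (j + 1) * ρ ^ n := by
      gcongr
      exact j.le_succ
    have hn : ‖(n / 2 : ℂ)‖ ≤ n := by
      rw [norm_div, Complex.norm_natCast]
      simp only [Complex.norm_ofNat]
      linarith [n.cast_nonneg (α := ℝ)]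
    have hs : ‖powCoeff a b u (deriv G) n m +
        n / 2 * (powCoeff a b u G (n - 1) m + powCoeff a b u G (n + 1) m)‖ ≤
        ‖powCoeff a b u (deriv G) n m‖ +
        n * (‖powCoeff a b u G (n - 1) m‖ + ‖powCoeff a b u G (n + 1) m‖) := by
      refine (norm_add_le _ _).trans ?_
      rw [norm_mul]
      gcongr
      exact norm_add_le _ _
    calc |(m : ℝ)| ^ (j + 1) * ‖powCoeff a b u G n m‖
        = |(m : ℝ)| ^ j * (|(m : ℝ)| * ‖powCoeff a b u G n m‖) := by ring
      _ ≤ |(m : ℝ)| ^ j * (‖powCoeff a b u (deriv G) n m‖ +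
          n * (‖powCoeff a b u G (n - 1) m‖ + ‖powCoeff a b u G (n + 1) m‖)) := by
        rw [hp]; gcongr
      _ = |(m : ℝ)| ^ j * ‖powCoeff a b u (deriv G) n m‖ +
          (n * (|(m : ℝ)| ^ j * ‖powCoeff a b u G (n - 1) m‖) +
          n * (|(m : ℝ)| ^ j * ‖powCoeff a b u G (n + 1) m‖)) := by ring
      _ ≤ C₁ * (n + 1 : ℝ) ^ (j + 1) * ρ ^ n + ((n + 1) * (C₂ * (n + 1) ^ j * ρ ^ n * ρ⁻¹) +
          (n + 1) * (C₂ * (n + 1) ^ j * ρ ^ n * (2 ^ j * ρ))) := by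
        exact add_le_add (hb0.trans hb0') (add_le_add hb1 hb2)
      _ = _ := by ring

/-- Two integrations by parts give the summable `1 / m²`; the index `m = 0` needs the trivial bound.
-/
theorem exists_summable_bound_powCoeff {a b ρ : ℝ} (hab : a ≤ b) (hρ : 0 < ρ) {u G : ℝ → ℝ}
    (hu : ∀ x ∈ Set.Icc a b, HasDerivAt u ((1 + u x ^ 2) / 2) x)
    (hur : ∀ x ∈ Set.Icc a b, |u x| ≤ ρ) (hG : ContDiff ℝ ∞ G)
    (hGs : tsupport G ⊆ Set.Ioo a b) :
    ∃ B : ℤ → ℝ, Summable B ∧ ∀ (n : ℕ) (m : ℤ),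
      ‖powCoeff a b u G n m‖ ≤ B m * ((n + 1) ^ 2 * ρ ^ n) := by
  obtain ⟨C₀, hC₀, h₀⟩ := norm_powCoeff_le hab hρ hu hur 0 G hG hGs
  obtain ⟨C₂, hC₂, h₂⟩ := norm_powCoeff_le hab hρ hu hur 2 G hG hGs
  refine ⟨fun m => (Pi.single 0 C₀ : ℤ → ℝ) m + C₂ * (1 / (m : ℝ) ^ 2), ?_, fun n m => ?_⟩
  · exact (hasSum_pi_single (0 : ℤ) C₀).summable.add
      ((Real.summable_one_div_int_pow.2 one_lt_two).mul_left C₂)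
  · have e1 : (1 : ℝ) ≤ n + 1 := by linarith [n.cast_nonneg (α := ℝ)]
    by_cases hm : m = 0
    · subst hm
      have h := h₀ n 0
      simp only [pow_zero, one_mul, mul_one] at h
      simp only [Pi.single_eq_same, Int.cast_zero, ne_eq, OfNat.ofNat_ne_zero, not_false_eq_true,
        zero_pow, div_zero, mul_zero, add_zero]
      refine h.trans ?_
      gcongr
      exact le_mul_of_one_le_left (by positivity) (one_le_pow₀ e1)
    · have h := h₂ n m
      have hm' : (0 : ℝ) < (m : ℝ) ^ 2 := by positivity
      rw [sq_abs, mul_comm, ← le_div_iff₀ hm'] at h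
      simp only [Pi.single_eq_of_ne hm, zero_add]
      exact h.trans (le_of_eq (by ring))

/-! ### The reciprocal exponential on the lower arc -/

/-- Here `ratio (-x) = tan (x/2 + π/4)`, whence the Riccati equation required for the integration by
parts. -/
theorem hasDerivAt_ratio_neg {x : ℝ} (h : 1 - Real.sin x ≠ 0) :
    HasDerivAt (fun y => ratio (-y)) ((1 + ratio (-x) ^ 2) / 2) x := by
  have hr : (fun y => ratio (-y)) = fun y => Real.cos y / (1 - Real.sin y) := by
    funext y; simp [ratio, sub_eq_add_neg]
  have hs : 1 + Real.sin (-x) ≠ 0 := by rwa [Real.sin_neg, ← sub_eq_add_neg]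
  rw [hr, ratio_sq hs, Real.sin_neg]
  refine ((Real.hasDerivAt_cos x).div ((Real.hasDerivAt_sin x).const_sub 1) h).congr_deriv ?_
  rw [sub_neg_eq_add, ← sub_eq_add_neg]
  field_simp
  linear_combination 2 * Real.sin_sq_add_cos_sq x

theorem ratio_neg_mul {x : ℝ} (h : 1 - Real.sin x ≠ 0) :
    (ratio (-x) : ℂ) * (1 + Complex.I * Complex.exp (Complex.I * x)) =
      Complex.exp (Complex.I * x) + Complex.I := by
  have hz : Complex.exp (Complex.I * x) = Real.cos x + Real.sin x * Complex.I := by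
    rw [mul_comm, Complex.exp_mul_I]; push_cast; rfl
  have hsc : (Real.cos x : ℂ) ^ 2 = 1 - (Real.sin x : ℂ) ^ 2 := by
    rw [eq_sub_iff_add_eq]; exact_mod_cast Real.cos_sq_add_sin_sq x
  have h' : (1 - Real.sin x : ℂ) ≠ 0 := by exact_mod_cast h
  rw [hz, ratio, Real.cos_neg, Real.sin_neg, ← sub_eq_add_neg]
  push_cast at *
  field_simp
  linear_combination Complex.cos x * Complex.sin x * Complex.I_sq + Complex.I * hsc

theorem sin_le_neg_sin {β x : ℝ} (hβ : 0 < β) (hβ' : β < Real.pi / 2)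
    (hx : x ∈ Set.Icc (-Real.pi + β) (-β)) : Real.sin x ≤ -Real.sin β := by
  obtain ⟨h1, h2⟩ := hx
  rw [le_neg, ← Real.sin_neg]
  rcases le_total (-x) (Real.pi / 2) with h | h
  · exact Real.sin_le_sin_of_le_of_le_pi_div_two (by linarith) h (by linarith)
  · rw [← Real.sin_pi_sub (-x)]
    exact Real.sin_le_sin_of_le_of_le_pi_div_two (by linarith) (by linarith) (by linarith)

theorem sin_mem_Ioo {β : ℝ} (hβ : 0 < β) (hβ' : β < Real.pi / 2) :
    Real.sin β ∈ Set.Ioo 0 1 := by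
  refine ⟨Real.sin_pos_of_pos_of_lt_pi hβ (by linarith [Real.pi_pos]), ?_⟩
  rw [← Real.sin_pi_div_two]
  exact Real.sin_lt_sin_of_lt_of_le_pi_div_two (by linarith) le_rfl hβ'

theorem abs_ratio_neg_le {β x : ℝ} (hβ : 0 < β) (hβ' : β < Real.pi / 2)
    (hx : x ∈ Set.Icc (-Real.pi + β) (-β)) : |ratio (-x)| ≤ |ratio β| := by
  have h := sin_le_neg_sin hβ hβ' hx
  obtain ⟨h0, h1⟩ := sin_mem_Ioo hβ hβ'
  apply sq_le_sq.1
  rw [ratio_sq (by rw [Real.sin_neg]; linarith), ratio_sq (by linarith), Real.sin_neg,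
    div_le_div_iff₀ (by linarith) (by linarith)]
  nlinarith

/-- The product is `|ratio β / ratio α|`, and `(1 - s)/(1 + s)` is strictly decreasing in `s`. This
is where the gap between `α` and `β` enters. -/
theorem abs_ratio_mul_lt_one {α β : ℝ} (hα : 0 < α) (hαβ : α < β) (hβ : β < Real.pi / 2) :
    |ratio (-α)| * |ratio β| < 1 := by
  obtain ⟨h0, h1⟩ := sin_mem_Ioo hα (hαβ.trans hβ)
  obtain ⟨h2, h3⟩ := sin_mem_Ioo (hα.trans hαβ) hβ
  have h4 : Real.sin α < Real.sin β :=
    Real.sin_lt_sin_of_lt_of_le_pi_div_two (by linarith) hβ.le hαβ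
  rw [← abs_mul, ← sq_lt_one_iff_abs_lt_one, mul_pow, ratio_sq (by rw [Real.sin_neg]; linarith),
    ratio_sq (by linarith), Real.sin_neg, div_mul_div_comm, div_lt_one (by nlinarith)]
  nlinarith

/-! ### The pairing that does not depend on the row -/

theorem summable_bounded_mul {c P : ℤ → ℂ} (hc : Summable fun m => ‖c m‖) {K : ℝ}
    (hP : ∀ m, ‖P m‖ ≤ K) : Summable fun m => P m * c m := by
  refine Summable.of_norm_bounded (hc.mul_left K) fun m => ?_
  rw [norm_mul]
  exact mul_le_mul_of_nonneg_right (hP m) (norm_nonneg _)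

/-- Summation by parts. The hypothesis `h` is the discrete entire equation with `Q` a row and `P`
the next one; absolute summability of `c` permits the shifts. -/
theorem tsum_pairing_eq {c P Q : ℤ → ℂ} (hc : Summable fun m => ‖c m‖) {K L : ℝ}
    (hP : ∀ m, ‖P m‖ ≤ K) (hQ : ∀ m, ‖Q m‖ ≤ L)
    (h : ∀ m, P (m + 1) + Complex.I * P m = Q m + Complex.I * Q (m + 1)) :
    ∑' m, P m * (c (m - 1) + Complex.I * c m) = ∑' m, Q m * (c m + Complex.I * c (m - 1)) := by
  have shift : ∀ R : ℤ → ℂ, ∑' m, R m * c (m - 1) = ∑' m, R (m + 1) * c m := by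
    intro R
    rw [← (Equiv.addRight (1 : ℤ)).tsum_eq]
    simp
  have hc1 : Summable fun m => ‖c (m - 1)‖ := (Equiv.subRight (1 : ℤ)).summable_iff.2 hc
  have s1 := summable_bounded_mul hc hP
  have s2 := summable_bounded_mul hc hQ
  have s3 := summable_bounded_mul hc1 hP
  have s4 := summable_bounded_mul hc1 hQ
  have s5 := summable_bounded_mul hc (fun m => hP (m + 1))
  have s6 := summable_bounded_mul hc (fun m => hQ (m + 1))
  calc ∑' m, P m * (c (m - 1) + Complex.I * c m)
      = ∑' m, (P m * c (m - 1) + Complex.I * (P m * c m)) := tsum_congr fun m => by ring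
    _ = ∑' m, (P (m + 1) * c m + Complex.I * (P m * c m)) := by
      rw [s3.tsum_add (s1.mul_left _), s5.tsum_add (s1.mul_left _), shift]
    _ = ∑' m, (Q m * c m + Complex.I * (Q (m + 1) * c m)) := tsum_congr fun m => by
      linear_combination c m * h m
    _ = ∑' m, (Q m * c m + Complex.I * (Q m * c (m - 1))) := by
      rw [s2.tsum_add (s6.mul_left _), s2.tsum_add (s4.mul_left _), tsum_mul_left, tsum_mul_left,
        shift]
    _ = _ := tsum_congr fun m => by ring

theorem exp_shift (m : ℤ) (t : ℝ) : Complex.exp (-(Complex.I * ((m - 1 : ℤ) : ℂ) * t)) =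
    Complex.exp (-(Complex.I * m * t)) * Complex.exp (Complex.I * t) := by
  rw [← Complex.exp_add]
  congr 1
  push_cast
  ring

/-- `ratio_neg_mul` integrated against `g u^n e^{-imt}`; multiplication by `e^{it}` is the shift `m
↦ m - 1`. -/
theorem powCoeff_succ {a b : ℝ} (hab : a ≤ b) {G : ℝ → ℝ} (hG : Continuous G)
    (hs : ∀ x ∈ Set.Icc a b, 1 - Real.sin x ≠ 0) (n : ℕ) (m : ℤ) :
    powCoeff a b (fun x => ratio (-x)) G (n + 1) m +
        Complex.I * powCoeff a b (fun x => ratio (-x)) G (n + 1) (m - 1) =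
      powCoeff a b (fun x => ratio (-x)) G n (m - 1) +
        Complex.I * powCoeff a b (fun x => ratio (-x)) G n m := by
  have hu : ContinuousOn (fun x => ratio (-x)) (Set.uIcc a b) := by
    rw [Set.uIcc_of_le hab]
    exact fun x hx => (hasDerivAt_ratio_neg (hs x hx)).continuousAt.continuousWithinAt
  have hi := fun (k : ℕ) (l : ℤ) =>
    (continuousOn_powCoeff_integrand hu hG.continuousOn k l).intervalIntegrable (μ := volume)
  unfold powCoeff
  rw [← intervalIntegral.integral_const_mul, ← intervalIntegral.integral_const_mul,
    ← intervalIntegral.integral_add (hi _ _) ((hi _ _).const_mul _),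
    ← intervalIntegral.integral_add (hi _ _) ((hi _ _).const_mul _)]
  refine intervalIntegral.integral_congr fun x hx => ?_
  rw [Set.uIcc_of_le hab] at hx
  simp only [exp_shift]
  push_cast
  linear_combination (G x : ℂ) * (ratio (-x) : ℂ) ^ n * Complex.exp (-(Complex.I * m * x)) *
    ratio_neg_mul (hs x hx)

/-- The pairing of the row `0` of a function in `PW_α` with the Fourier coefficients of
`(1 + i e^{it}) g(t)` vanishes, for test functions `g` living where `|e_t(0,1)|` exceeds the
exponential type. -/
theorem tsum_mul_powCoeff_eq_zero {α β : ℝ} (hα : 0 < α) (hαβ : α < β) (hβ : β < Real.pi / 2)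
    {F : ℤ × ℤ → ℂ} (hF : F ∈ paleyWiener α) {g : ℝ → ℝ} (hg : ContDiff ℝ ∞ g)
    (hgs : tsupport g ⊆ Set.Ioo (-Real.pi + β) (-β)) :
    ∑' m : ℤ, F (m, 0) * (powCoeff (-Real.pi + β) (-β) (fun x => ratio (-x)) g 0 m +
      Complex.I * powCoeff (-Real.pi + β) (-β) (fun x => ratio (-x)) g 0 (m - 1)) = 0 := by
  obtain ⟨hFe, ⟨K, hK, hFb⟩, -⟩ := hF
  rw [norm_discreteExp_zero_one] at hFb
  have hβ0 := hα.trans hαβ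
  have hab : -Real.pi + β ≤ -β := by linarith
  have hs1 := sin_mem_Ioo hβ0 hβ
  have hs : ∀ x ∈ Set.Icc (-Real.pi + β) (-β), 1 - Real.sin x ≠ 0 := by
    intro x hx
    have := sin_le_neg_sin hβ0 hβ hx
    linarith [hs1.1]
  have hcos : 0 < Real.cos β := Real.cos_pos_of_mem_Ioo ⟨by linarith, hβ⟩
  have hρ : 0 < |ratio β| := abs_pos.2 (div_pos hcos (by linarith [hs1.1])).ne'
  have hM : 0 < |ratio (-α)| := by
    refine abs_pos.2 (div_pos ?_ ?_).ne'
    · rw [Real.cos_neg]; exact Real.cos_pos_of_mem_Ioo ⟨by linarith, by linarith⟩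
    · rw [Real.sin_neg]; linarith [(sin_mem_Ioo hα (hαβ.trans hβ)).2]
  have hlt := abs_ratio_mul_lt_one hα hαβ hβ
  obtain ⟨B, hB, hcB⟩ := exists_summable_bound_powCoeff hab hρ
    (fun x hx => hasDerivAt_ratio_neg (hs x hx)) (fun x hx => abs_ratio_neg_le hβ0 hβ hx) hg hgs
  set c := powCoeff (-Real.pi + β) (-β) (fun x => ratio (-x)) g with hc
  set M := |ratio (-α)|
  set ρ := |ratio β|
  have hcs : ∀ n, Summable fun m => ‖c n m‖ := fun n =>
    Summable.of_nonneg_of_le (fun _ => norm_nonneg _) (hcB n) (hB.mul_right _)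
  have hFb' : ∀ (n : ℕ) (m : ℤ), ‖F (m, n)‖ ≤ K * M ^ n := by
    intro n m; simpa using hFb m n
  have hstep : ∀ n : ℕ, ∑' m : ℤ, F (m, n) * (c n m + Complex.I * c n (m - 1)) =
      ∑' m : ℤ, F (m, 0) * (c 0 m + Complex.I * c 0 (m - 1)) := by
    intro n
    induction n with
    | zero => simp
    | succ n ih =>
      rw [← ih, ← tsum_pairing_eq (hcs n) (hFb' (n + 1)) (hFb' n)]
      · refine tsum_congr fun m => ?_
        rw [hc, powCoeff_succ hab hg.continuous hs]
      · intro m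
        push_cast
        linear_combination hFe m n
  have hB1 : Summable fun m => B (m - 1) := (Equiv.subRight (1 : ℤ)).summable_iff.2 hB
  -- The factor `K / (M * ρ)` compensates for writing the bound at exponent `n + 1`, a shift of the
  -- null sequence `k² (Mρ)^k`.
  have hbound : ∀ n : ℕ, ‖∑' m : ℤ, F (m, 0) * (c 0 m + Complex.I * c 0 (m - 1))‖ ≤
      (∑' m, (B m + B (m - 1))) * (K / (M * ρ)) * (((n + 1 : ℕ) : ℝ) ^ 2 * (M * ρ) ^ (n + 1)) := by
    intro n
    rw [← hstep n]
    refine (tsum_of_norm_bounded (((hB.add hB1).mul_right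
      (K * M ^ n * (((n : ℝ) + 1) ^ 2 * ρ ^ n))).hasSum) fun m => ?_).trans (le_of_eq ?_)
    · rw [norm_mul]
      refine (mul_le_mul (hFb' n m) (norm_add_le _ _) (norm_nonneg _) (by positivity)).trans ?_
      rw [norm_mul, Complex.norm_I, one_mul]
      have := add_le_add (hcB n m) (hcB n (m - 1))
      refine (mul_le_mul_of_nonneg_left this (by positivity)).trans (le_of_eq (by ring))
    · rw [tsum_mul_right, pow_succ (M * ρ), mul_pow]
      push_cast
      field_simp
  have hlim := ((tendsto_add_atTop_iff_nat 1).2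
    (tendsto_pow_const_mul_const_pow_of_lt_one 2 (by positivity) hlt)).const_mul
      ((∑' m, (B m + B (m - 1))) * (K / (M * ρ)))
  rw [mul_zero] at hlim
  exact norm_le_zero_iff.1 (ge_of_tendsto' hlim hbound)

/-! ### Vanishing of the spectral function off `D_α` -/

theorem integral_Ioc_eq_of_tsupport {β : ℝ} (hβ : 0 < β)
    {g : ℝ → ℝ} (hgs : tsupport g ⊆ Set.Ioo (-Real.pi + β) (-β)) (w : ℝ → ℂ) :
    ∫ x in (-Real.pi)..(-Real.pi + 2 * Real.pi), (g x : ℂ) * w x = ∫ x, (g x : ℂ) * w x ∧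
      ∫ x in (-Real.pi + β)..(-β), (g x : ℂ) * w x = ∫ x, (g x : ℂ) * w x := by
  have hsupp : (Function.support fun x => (g x : ℂ) * w x) ⊆ Set.Ioo (-Real.pi + β) (-β) := by
    intro x hx
    apply hgs
    apply subset_tsupport
    intro h0
    simp [h0] at hx
  constructor
  · refine intervalIntegral.integral_eq_integral_of_support_subset (hsupp.trans ?_)
    intro x hx
    exact ⟨by linarith [hx.1], by linarith [hx.2, Real.pi_pos]⟩
  · exact intervalIntegral.integral_eq_integral_of_support_subset
      (hsupp.trans Set.Ioo_subset_Ioc_self)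

/-- The periodization of `(1 + i e^{it}) g` has Fourier coefficients `(c₀(m) + i c₀(m-1)) / 2π`, so
Parseval identifies this integral with the vanishing pairing, up to a constant. -/
theorem integral_test_mul_eq_zero {α β : ℝ} (hα : 0 < α) (hαβ : α < β) (hβ : β < Real.pi / 2)
    {F : ℤ × ℤ → ℂ} (hF : F ∈ paleyWiener α) {f : Torus → ℂ} (hf : MemLp f 2)
    (hFf : ∀ m : ℤ, synthesis f (m, 0) = F (m, 0)) {g : ℝ → ℝ} (hg : ContDiff ℝ ∞ g)
    (hgs : tsupport g ⊆ Set.Ioo (-Real.pi + β) (-β)) :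
    ∫ x : ℝ, (g x : ℂ) * ((1 + Complex.I * Complex.exp (Complex.I * x)) * f (x : Torus)) = 0 := by
  have hcpt : HasCompactSupport g := HasCompactSupport.of_support_subset_isCompact isCompact_Icc
    ((subset_tsupport g).trans (hgs.trans Set.Ioo_subset_Icc_self))
  have hgc := hg.continuous
  set w : ℝ → ℂ := fun t => (g t : ℂ) * (1 + Complex.I * Complex.exp (Complex.I * t)) with hw
  have hwc : Continuous w := by fun_prop
  have hws : HasCompactSupport w :=
    HasCompactSupport.mul_right (hcpt.comp_left Complex.ofReal_zero)
  set G : Torus → ℂ := AddCircle.liftIoc (2 * Real.pi) (-Real.pi) w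
  have hG : MemLp G 2 := ((hwc.memLp_of_hasCompactSupport hws).restrict _).memLp_liftIoc
  have hlift : ∀ x ∈ Set.uIoc (-Real.pi) (-Real.pi + 2 * Real.pi), G (x : Torus) = w x := by
    intro x hx
    rw [Set.uIoc_of_le (by linarith [Real.pi_pos])] at hx
    exact AddCircle.liftIoc_coe_apply hx
  have hI := integral_Ioc_eq_of_tsupport (hα.trans hαβ) hgs
  set c := powCoeff (-Real.pi + β) (-β) (fun x => ratio (-x)) g with hc
  have hc0 : ∀ m, c 0 m = ∫ x : ℝ, (g x : ℂ) * Complex.exp (-(Complex.I * m * x)) := by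
    intro m
    rw [hc, powCoeff, ← (hI _).2]
    simp
  have hint : ∀ m : ℤ, Integrable
      fun x : ℝ => (g x : ℂ) * Complex.exp (-(Complex.I * m * x)) := fun m =>
    Continuous.integrable_of_hasCompactSupport (by fun_prop)
      (HasCompactSupport.mul_right (hcpt.comp_left Complex.ofReal_zero))
  have hcoef : ∀ m : ℤ, fourierCoeff G m =
      (2 * Real.pi : ℂ)⁻¹ * (c 0 m + Complex.I * c 0 (m - 1)) := by
    intro m
    rw [fourierCoeff_eq_intervalIntegral G m (-Real.pi), Complex.real_smul, one_div]
    push_cast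
    congr 1
    rw [hc0, hc0, ← integral_const_mul, ← integral_add (hint _) ((hint _).const_mul _)]
    have e : ∀ x : ℝ, (g x : ℂ) * Complex.exp (-(Complex.I * m * x)) +
        Complex.I * ((g x : ℂ) * Complex.exp (-(Complex.I * ((m - 1 : ℤ) : ℂ) * x))) =
        (g x : ℂ) * (Complex.exp (-(Complex.I * m * x)) *
          (1 + Complex.I * Complex.exp (Complex.I * x))) := by
      intro x
      rw [exp_shift]
      ring
    rw [integral_congr_ae (ae_of_all _ e), ← (hI _).1]
    refine intervalIntegral.integral_congr_ae (ae_of_all _ fun x hx => ?_)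
    have he : (fourier (-m) (x : Torus) : ℂ) = Complex.exp (-(Complex.I * m * x)) := by
      rw [fourier_coe_apply]
      congr 1
      have : (Real.pi : ℂ) ≠ 0 := by exact_mod_cast Real.pi_ne_zero
      push_cast
      field_simp
    rw [hlift x hx, he, smul_eq_mul, hw]
    ring
  have h0 := tsum_mul_powCoeff_eq_zero hα hαβ hβ hF hg hgs
  have h1 := (hasSum_fourierCoeff_mul_synthesis hf hG).tsum_eq
  have hpi : (2 * Real.pi : ℂ)⁻¹ ≠ 0 := by
    have : (Real.pi : ℂ) ≠ 0 := by exact_mod_cast Real.pi_ne_zero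
    simp [this]
  have h2 : ∫ t : Torus, G t * f t = 0 := by
    refine (mul_eq_zero.1 (h1.symm.trans ?_)).resolve_left hpi
    rw [← mul_zero (2 * Real.pi : ℂ)⁻¹, ← h0, ← tsum_mul_left]
    refine tsum_congr fun m => ?_
    rw [hcoef, hFf]
    ring
  rw [← (hI _).1, ← h2, ← AddCircle.intervalIntegral_preimage _ (-Real.pi)]
  refine intervalIntegral.integral_congr_ae (ae_of_all _ fun x hx => ?_)
  rw [hlift x hx, hw]
  ring

/-- A compact subset of an open arc leaves room for some `β > α`, as the strict inequality `Mρ < 1`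
demands. -/
theorem exists_tsupport_subset_Ioo {α : ℝ} (hα' : α < Real.pi / 2) {K : Set ℝ}
    (hK : IsCompact K) (hKs : K ⊆ Set.Ioo (-Real.pi + α) (-α)) :
    ∃ β, α < β ∧ β < Real.pi / 2 ∧ K ⊆ Set.Ioo (-Real.pi + β) (-β) := by
  rcases K.eq_empty_or_nonempty with rfl | hne
  · obtain ⟨β, h1, h2⟩ := exists_between hα'
    exact ⟨β, h1, h2, Set.empty_subset _⟩
  · obtain ⟨x, hx, hxl⟩ := hK.exists_isLeast hne
    obtain ⟨y, hy, hyg⟩ := hK.exists_isGreatest hne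
    have h : α < min (min (x + Real.pi) (-y)) (Real.pi / 2) := by
      refine lt_min (lt_min ?_ ?_) hα'
      · linarith [(hKs hx).1]
      · linarith [(hKs hy).2]
    obtain ⟨β, h1, h2⟩ := exists_between h
    obtain ⟨h3, h4⟩ := lt_min_iff.1 h2
    obtain ⟨h5, h6⟩ := lt_min_iff.1 h3
    exact ⟨β, h1, h4, fun z hz => ⟨by linarith [hxl hz], by linarith [hyg hz]⟩⟩

theorem one_add_I_mul_exp_ne_zero {x : ℝ} (h : 1 - Real.sin x ≠ 0) :
    1 + Complex.I * Complex.exp (Complex.I * x) ≠ 0 := by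
  intro h0
  have h1 := congrArg Complex.re h0
  have hz : Complex.exp (Complex.I * x) = Real.cos x + Real.sin x * Complex.I := by
    rw [mul_comm, Complex.exp_mul_I]; push_cast; rfl
  rw [hz] at h1
  simp only [Complex.add_re, Complex.one_re, Complex.mul_re, Complex.I_re, Complex.ofReal_re,
    Complex.ofReal_im, Complex.I_im, Complex.add_im, Complex.mul_im, Complex.zero_re] at h1
  exact h (by linarith)

/-- The spectral function of `F ∈ PW_α` vanishes on the arc where `|e_t(0,1)|` exceeds the
exponential type. -/
theorem ae_eq_zero_of_mem_paleyWiener {α : ℝ} (hα : 0 < α) (hα' : α < Real.pi / 2)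
    {F : ℤ × ℤ → ℂ} (hF : F ∈ paleyWiener α) {f : Torus → ℂ} (hf : MemLp f 2)
    (hFf : ∀ m : ℤ, synthesis f (m, 0) = F (m, 0)) :
    ∀ᵐ x : ℝ, x ∈ Set.Ioo (-Real.pi + α) (-α) → f (x : Torus) = 0 := by
  have hfi : IntegrableOn (fun x : ℝ => f (x : Torus))
      (Set.Ioc (-Real.pi) (-Real.pi + 2 * Real.pi)) :=
    (AddCircle.measurePreserving_mk (2 * Real.pi) (-Real.pi)).integrable_comp_of_integrable
      (hf.integrable one_le_two)
  have hsub : Set.Ioo (-Real.pi + α) (-α) ⊆ Set.Ioc (-Real.pi) (-Real.pi + 2 * Real.pi) :=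
    fun x hx => ⟨by linarith [hx.1], by linarith [hx.2, Real.pi_pos]⟩
  have hc : Continuous fun x : ℝ => 1 + Complex.I * Complex.exp (Complex.I * x) := by fun_prop
  have hloc : LocallyIntegrableOn
      (fun x : ℝ => (1 + Complex.I * Complex.exp (Complex.I * x)) * f (x : Torus))
      (Set.Ioo (-Real.pi + α) (-α)) :=
    (hfi.mono_set hsub).locallyIntegrableOn.continuousOn_mul hc.continuousOn
      isOpen_Ioo.isLocallyClosed
  filter_upwards [isOpen_Ioo.ae_eq_zero_of_integral_contDiff_smul_eq_zero hloc
    (fun g hg hgc hgs => by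
      obtain ⟨β, h1, h2, h3⟩ := exists_tsupport_subset_Ioo hα' hgc hgs
      simpa only [Complex.real_smul] using
        integral_test_mul_eq_zero hα h1 h2 hF hf hFf hg h3)] with x hx hxm
  refine (mul_eq_zero.1 (hx hxm)).resolve_left (one_add_I_mul_exp_ne_zero ?_)
  have h1 := sin_le_neg_sin hα hα' (Set.Ioo_subset_Icc_self hxm)
  linarith [(sin_mem_Ioo hα hα').1]

theorem paleyWiener_reflect {α : ℝ} {F : ℤ × ℤ → ℂ} (hF : F ∈ paleyWiener α) :
    (fun p : ℤ × ℤ => F (-p.1, -p.2)) ∈ paleyWiener α := by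
  obtain ⟨h1, ⟨c, hc, h2⟩, h3⟩ := hF
  refine ⟨h1.reflect, ⟨c, hc, fun m n => ?_⟩, ?_⟩
  · simpa using h2 (-m) (-n)
  · simpa [Function.comp_def] using (Equiv.neg ℤ).summable_iff.2 h3

theorem synthesis_reflect_row_zero (f : Torus → ℂ) (m : ℤ) :
    synthesis (fun t => f (-t)) (m, 0) = synthesis f (-m, 0) := by
  rw [synthesis, synthesis, ← integral_neg_eq_self]
  congr 1
  refine integral_congr_ae (ae_of_all _ fun t => ?_)
  simp only [discreteExp_row_zero, neg_neg, fourier_apply, smul_neg, neg_smul]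

/-- The spectral function of `F ∈ PW_α` is concentrated on `D_α`. -/
theorem ae_eq_zero_off_spectralSet {α : ℝ} (hα : 0 < α) (hα' : α < Real.pi / 2)
    {F : ℤ × ℤ → ℂ} (hF : F ∈ paleyWiener α) {f : Torus → ℂ} (hfm : Measurable f)
    (hf : MemLp f 2) (hFf : ∀ m : ℤ, synthesis f (m, 0) = F (m, 0)) :
    ∀ᵐ t : Torus, t ∉ spectralSet α → f t = 0 := by
  have h1 := ae_eq_zero_of_mem_paleyWiener hα hα' hF hf hFf
  -- Reflecting the lattice turns `f(t)` into `f(-t)`, which exchanges the two arcs complementary to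
  -- `D_α`.
  have h2 := ae_eq_zero_of_mem_paleyWiener hα hα' (paleyWiener_reflect hF)
    (f := fun t => f (-t)) (hf.comp_measurePreserving (Measure.measurePreserving_neg _))
    (fun m => by rw [synthesis_reflect_row_zero, hFf]; simp)
  have h3 := (Measure.measurePreserving_neg (volume : Measure ℝ)).quasiMeasurePreserving.ae h2
  have hms : MeasurableSet {t : Torus | t ∉ spectralSet α → f t = 0} := by
    have : {t : Torus | t ∉ spectralSet α → f t = 0} = spectralSet α ∪ f ⁻¹' {0} := by
      ext t
      simp [imp_iff_not_or]
    rw [this]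
    exact (isClosed_spectralSet α).measurableSet.union (hfm (measurableSet_singleton 0))
  rw [← (AddCircle.measurePreserving_mk (2 * Real.pi) (-Real.pi)).map_eq,
    ae_map_iff (AddCircle.measurePreserving_mk (2 * Real.pi) (-Real.pi)).measurable.aemeasurable
      hms, ae_restrict_iff' measurableSet_Ioc]
  filter_upwards [h1, h3] with x hx1 hx2 hx hxs
  have hx' : x ∉ {x : ℝ | |x| ≤ α} ∪ {x : ℝ | Real.pi - α ≤ |x| ∧ |x| ≤ Real.pi} :=
    fun h => hxs ⟨x, h, rfl⟩
  simp only [Set.mem_union, Set.mem_ofPred_eq, not_or, not_and, not_le] at hx'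
  obtain ⟨hxa, hxb⟩ := hx'
  have hxp : |x| ≤ Real.pi := abs_le.2 ⟨hx.1.le, by linarith [hx.2]⟩
  have hxb' : |x| < Real.pi - α := by
    by_contra h
    exact absurd (hxb (not_lt.1 h)) (not_lt.2 hxp)
  rcases abs_cases x with ⟨h, _⟩ | ⟨h, _⟩
  · have := hx2 ⟨by linarith, by linarith⟩
    simpa using this
  · exact hx1 ⟨by linarith, by linarith⟩

/-! ### Synthesis from a spectral function on `D_α` -/

theorem isDiscreteEntire_discreteExp {x : ℝ} (h1 : 1 + Real.sin x ≠ 0) (h2 : 1 - Real.sin x ≠ 0) :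
    IsDiscreteEntire (discreteExp (x : Torus)) := by
  intro m n
  have hc : Real.cos x ≠ 0 := by
    intro h0
    have : (1 + Real.sin x) * (1 - Real.sin x) = Real.cos x ^ 2 := by rw [Real.cos_sq']; ring
    rw [h0, zero_pow two_ne_zero] at this
    exact mul_ne_zero h1 h2 this
  have hr : (ratio x : ℂ) ≠ 0 := by exact_mod_cast div_ne_zero hc h1
  have hk := ratio_neg_mul h2
  rw [ratio_neg x hc, Complex.ofReal_inv, inv_mul_eq_iff_eq_mul₀ hr] at hk
  have he : Complex.exp (Complex.I * x * ((m + 1 : ℤ) : ℂ)) =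
      Complex.exp (Complex.I * x * m) * Complex.exp (Complex.I * x) := by
    rw [← Complex.exp_add]; congr 1; push_cast; ring
  simp only [discreteExp_ratio, he, zpow_add_one₀ hr]
  linear_combination (-Complex.exp (Complex.I * x * m) * (ratio x : ℂ) ^ n) * hk

section Synthesis

variable {α : ℝ} {f : Torus → ℂ}

theorem integrable_mul_discreteExp (hα : 0 < α) (hα' : α < Real.pi / 2) (hf : Integrable f)
    (hs : ∀ᵐ t : Torus, t ∉ spectralSet α → f t = 0) (m n : ℤ) :
    Integrable (fun t : Torus => f t * discreteExp t (m, n)) := by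
  refine Integrable.mono' (hf.norm.mul_const
    (‖discreteExp ((-α : ℝ) : Torus) (0, 1)‖ ^ n.natAbs))
    (hf.aestronglyMeasurable.mul (measurable_discreteExp _).aestronglyMeasurable) ?_
  filter_upwards [hs] with t ht
  rw [norm_mul]
  by_cases h : t ∈ spectralSet α
  · exact mul_le_mul_of_nonneg_left (norm_discreteExp_le_of_mem_spectralSet hα hα' h m n)
      (norm_nonneg _)
  · simp [ht h]

theorem norm_synthesis_le (hα : 0 < α) (hα' : α < Real.pi / 2) (hf : Integrable f)
    (hs : ∀ᵐ t : Torus, t ∉ spectralSet α → f t = 0) (m n : ℤ) :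
    ‖synthesis f (m, n)‖ ≤ (‖(1 / (2 * (Real.pi : ℂ)))‖ * ∫ t : Torus, ‖f t‖) *
      ‖discreteExp ((-α : ℝ) : Torus) (0, 1)‖ ^ n.natAbs := by
  rw [synthesis, norm_mul, mul_assoc, ← integral_mul_const]
  refine mul_le_mul_of_nonneg_left ?_ (norm_nonneg _)
  refine norm_integral_le_of_norm_le (hf.norm.mul_const _) ?_
  filter_upwards [hs] with t ht
  rw [norm_mul]
  by_cases h : t ∈ spectralSet α
  · exact mul_le_mul_of_nonneg_left (norm_discreteExp_le_of_mem_spectralSet hα hα' h m n)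
      (norm_nonneg _)
  · simp [ht h]

theorem isDiscreteEntire_synthesis (hα : 0 < α) (hα' : α < Real.pi / 2) (hf : Integrable f)
    (hs : ∀ᵐ t : Torus, t ∉ spectralSet α → f t = 0) : IsDiscreteEntire (synthesis f) := by
  intro m n
  have hi := integrable_mul_discreteExp hα hα' hf hs
  simp only [synthesis]
  rw [← mul_sub, ← mul_sub, mul_left_comm, ← integral_sub (hi _ _) (hi _ _),
    ← integral_sub (hi _ _) (hi _ _), ← integral_const_mul (-Complex.I)]
  congr 1
  refine integral_congr_ae ?_
  filter_upwards [hs] with t ht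
  by_cases h : t ∈ spectralSet α
  · obtain ⟨x, rfl, hx⟩ := abs_sin_le_of_mem_spectralSet hα hα' h
    obtain ⟨h1, h2⟩ := abs_le.1 hx
    have h3 := (sin_mem_Ioo hα hα').2
    linear_combination f (x : Torus) *
      isDiscreteEntire_discreteExp (x := x) (by linarith) (by linarith) m n
  · simp [ht h]

theorem synthesis_mem_paleyWiener (hα : 0 < α) (hα' : α < Real.pi / 2) (hf : MemLp f 2)
    (hs : ∀ᵐ t : Torus, t ∉ spectralSet α → f t = 0) : synthesis f ∈ paleyWiener α := by
  have hfi := hf.integrable one_le_two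
  -- The summand 1 keeps the constant positive even when `f = 0`.
  refine ⟨isDiscreteEntire_synthesis hα hα' hfi hs,
    ⟨‖(1 / (2 * (Real.pi : ℂ)))‖ * (∫ t : Torus, ‖f t‖) + 1, ?_, fun m n => ?_⟩,
    (hasSum_sq_synthesis_row_zero hf).summable⟩
  · have : 0 ≤ ∫ t : Torus, ‖f t‖ := integral_nonneg fun _ => norm_nonneg _
    positivity
  · refine (norm_synthesis_le hα hα' hfi hs m n).trans ?_
    gcongr
    linarith

end Synthesis

/-- A function in `PW_α` is determined by its row `n = 0`. -/
theorem paleyWiener_ext {α : ℝ} {F G : ℤ × ℤ → ℂ} (hF : F ∈ paleyWiener α)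
    (hG : G ∈ paleyWiener α) (h : ∀ m : ℤ, F (m, 0) = G (m, 0)) : F = G := by
  obtain ⟨hF1, ⟨c, -, hc⟩, -⟩ := hF
  obtain ⟨hG1, ⟨d, -, hd⟩, -⟩ := hG
  funext ⟨m, n⟩
  refine sub_eq_zero.1 (IsDiscreteEntire.eq_zero (H := fun p => F p - G p) ?_ ?_ ?_ m n)
  · intro m n
    linear_combination hF1 m n - hG1 m n
  · exact fun n => ⟨_, fun m => (norm_sub_le _ _).trans (add_le_add (hc m n) (hd m n))⟩
  · exact fun m => sub_eq_zero.2 (h m)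

end DiscretePaleyWiener

end

theorem mainTheorem1 (α : ℝ) (hα : 0 < α) (hα' : α < Real.pi / 2) :
    (∀ F : ℤ × ℤ → ℂ, F ∈ DiscretePaleyWiener.paleyWiener α →
      ∃ f : Lp ℂ 2 (volume : Measure DiscretePaleyWiener.Torus),
        DiscretePaleyWiener.essSupport f ⊆ DiscretePaleyWiener.spectralSet α ∧
        (∀ m n : ℤ,
          Integrable (fun t : DiscretePaleyWiener.Torus =>
            f t * DiscretePaleyWiener.discreteExp t (m, n)) ∧
          F (m, n) = DiscretePaleyWiener.synthesis f (m, n)) ∧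
        DiscretePaleyWiener.pwNorm F = (2 * Real.pi) ^ (-(1 / 2) : ℝ) * ‖f‖) ∧
    (∀ f : Lp ℂ 2 (volume : Measure DiscretePaleyWiener.Torus),
      DiscretePaleyWiener.essSupport f ⊆ DiscretePaleyWiener.spectralSet α →
        (∀ m n : ℤ,
          Integrable (fun t : DiscretePaleyWiener.Torus =>
            f t * DiscretePaleyWiener.discreteExp t (m, n))) ∧
        DiscretePaleyWiener.synthesis f ∈ DiscretePaleyWiener.paleyWiener α ∧
        DiscretePaleyWiener.pwNorm (DiscretePaleyWiener.synthesis f) =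
          (2 * Real.pi) ^ (-(1 / 2) : ℝ) * ‖f‖) := by
  constructor
  · intro F hF
    obtain ⟨f, hf⟩ := DiscretePaleyWiener.exists_synthesis_row_zero hF.2.2
    have hs := DiscretePaleyWiener.ae_eq_zero_off_spectralSet hα hα' hF
      (Lp.stronglyMeasurable f).measurable (Lp.memLp f) hf
    -- Only now is `synthesis f` known to lie in the space: concentration on `D_α` had to be proved
    -- from the row `n = 0` first.
    have hFf : F = DiscretePaleyWiener.synthesis f :=
      DiscretePaleyWiener.paleyWiener_ext hF
        (DiscretePaleyWiener.synthesis_mem_paleyWiener hα hα' (Lp.memLp f) hs)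
        fun m => (hf m).symm
    refine ⟨f, DiscretePaleyWiener.essSupport_subset_of_ae
      (DiscretePaleyWiener.isClosed_spectralSet α) hs, fun m n => ⟨?_, ?_⟩, ?_⟩
    · exact DiscretePaleyWiener.integrable_mul_discreteExp hα hα'
        ((Lp.memLp f).integrable one_le_two) hs m n
    · rw [hFf]
    · rw [hFf, DiscretePaleyWiener.pwNorm_synthesis]
  · intro f hfs
    have hs := DiscretePaleyWiener.ae_eq_zero_of_essSupport_subset hfs
    exact ⟨DiscretePaleyWiener.integrable_mul_discreteExp hα hα'
        ((Lp.memLp f).integrable one_le_two) hs,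
      DiscretePaleyWiener.synthesis_mem_paleyWiener hα hα' (Lp.memLp f) hs,
      DiscretePaleyWiener.pwNorm_synthesis f⟩
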